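/- **Fundamental theorem of calculus for the Laplace integral.** *Laplace integral on $[a,b]$.* Let $a\le b$ be real and $f:[a,b]\to\mathbb{R}$. A continuous function $U:[a,b]\to\mathbb{R}$ is a major function of $f$ on $[a,b]$ if its lower Laplace derivates are at least $f$ on $[a,b]$, that is, if $$\liminf_{s\to\infty}s^2\int_0^\delta e^{-st}[U(x+t)-U(x)]\,dt\ \ge f(x)\quad(a\le x<x+\delta\le b),$$ $$\liminf_{s\to\infty}(-s^2)\int_0^\delta e^{-st}[U(x-t)-U(x)]\,dt\ \ge f(x)\quad(a\le x-\delta<x\le b)$$ (for continuous $U$ these derivates do not depend on $\delta>0$). A continuous $V$ is a minor function of $f$ if the corresponding upper derivates ($\limsup$ in place of $\liminf$) are at most $f$. The function $f$ is Laplace integrable on $[a,b]$ if major and minor functions exist and $$\inf_U\,[U(b)-U(a)]=\sup_V\,[V(b)-V(a)]\in\mathbb{R};$$ the common value is $\int_a^b f$. All integrals below are Laplace integrals. *Unbounded intervals.* $f\in\mathcal{LP}[a,\infty]$ means that $f$ is Laplace integrable on $[a,c]$ for every $c\ge a$ and that $\lim_{c\to\infty}\int_a^c f$ exists in $\mathbb{R}$.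 *Laplace derivative.* Let $g$ be Laplace integrable on a neighbourhood of $x$. If for some $\delta>0$ the limits $$\lim_{s\to\infty}s^2\int_0^\delta e^{-st}[g(x+t)-g(x)]\,dt,\qquad \lim_{s\to\infty}(-s^2)\int_0^\delta e^{-st}[g(x-t)-g(x)]\,dt$$ exist in $\mathbb{R}$ and are equal, then $g$ is Laplace differentiable at $x$ and the common value is denoted by $LD_1g(x)$. **Theorem.** Let $a\in\mathbb{R}$, let $f\in\mathcal{LP}[a,\infty]$ and let $F(x)=\int_a^x f$ for $x\ge a$. Then for almost every $x\in[a,\infty]$ the function $F$ is Laplace differentiable at $x$ and $LD_1F(x)=f(x)$. -/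

import Mathlib

open MeasureTheory Filter Set
open scoped Topology

noncomputable section

/-! The Perron-type Laplace integral and the Laplace derivative.

Functions are total functions `ℝ → ℝ`; every notion relative to an interval uses only the values
on that interval. -/

/-- `s² ∫₀^δ e^{-st} [U(x+t) - U(x)] dt`, with an ordinary integral.  It is used for functions `U`
that are continuous on `[x, x+δ]`. -/
def rightLaplaceQuot (U : ℝ → ℝ) (x δ s : ℝ) : ℝ :=
  s ^ 2 * ∫ t in (0 : ℝ)..δ, Real.exp (-(s * t)) * (U (x + t) - U x)

/-- `-s² ∫₀^δ e^{-st} [U(x-t) - U(x)] dt`, with an ordinary integral.  It is used for functions `U`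
that are continuous on `[x-δ, x]`. -/
def leftLaplaceQuot (U : ℝ → ℝ) (x δ s : ℝ) : ℝ :=
  (-s ^ 2) * ∫ t in (0 : ℝ)..δ, Real.exp (-(s * t)) * (U (x - t) - U x)

/-- `U` is a major function of `f` on `[a,b]`: it is continuous there and its lower Laplace
derivates are at least `f` (hence also `> -∞`) at every point of `[a,b]`; the derivates are
two-sided at interior points and one-sided at the endpoints.  For a continuous `U` the derivates
do not depend on the length `δ > 0` of the interval of integration. -/
structure IsLaplaceMajor (f : ℝ → ℝ) (a b : ℝ) (U : ℝ → ℝ) : Prop where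
  continuousOn : ContinuousOn U (Icc a b)
  le_right : ∀ x, a ≤ x → ∀ δ > 0, x + δ ≤ b →
    (f x : EReal) ≤ liminf (fun s : ℝ => (rightLaplaceQuot U x δ s : EReal)) atTop
  le_left : ∀ x, x ≤ b → ∀ δ > 0, a ≤ x - δ →
    (f x : EReal) ≤ liminf (fun s : ℝ => (leftLaplaceQuot U x δ s : EReal)) atTop

/-- `V` is a minor function of `f` on `[a,b]`: it is continuous there and its upper Laplace
derivates are at most `f` (hence also `< ∞`) at every point of `[a,b]`. -/
structure IsLaplaceMinor (f : ℝ → ℝ) (a b : ℝ) (V : ℝ → ℝ) : Prop where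
  continuousOn : ContinuousOn V (Icc a b)
  right_le : ∀ x, a ≤ x → ∀ δ > 0, x + δ ≤ b →
    limsup (fun s : ℝ => (rightLaplaceQuot V x δ s : EReal)) atTop ≤ (f x : EReal)
  left_le : ∀ x, x ≤ b → ∀ δ > 0, a ≤ x - δ →
    limsup (fun s : ℝ => (leftLaplaceQuot V x δ s : EReal)) atTop ≤ (f x : EReal)

/-- The increments `U(b) - U(a)` of the major functions of `f` on `[a,b]`. -/
def majorIncrements (f : ℝ → ℝ) (a b : ℝ) : Set ℝ :=
  {r | ∃ U, IsLaplaceMajor f a b U ∧ r = U b - U a}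

/-- The increments `V(b) - V(a)` of the minor functions of `f` on `[a,b]`. -/
def minorIncrements (f : ℝ → ℝ) (a b : ℝ) : Set ℝ :=
  {r | ∃ V, IsLaplaceMinor f a b V ∧ r = V b - V a}

/-- `f` is Laplace integrable on `[a,b]`, where `a ≤ b`: major and minor functions exist, and the
infimum of the increments of the former and the supremum of the increments of the latter are the
same real number. -/
def LaplaceIntegrable (f : ℝ → ℝ) (a b : ℝ) : Prop :=
  a ≤ b ∧ (majorIncrements f a b).Nonempty ∧ (minorIncrements f a b).Nonempty ∧
    ∃ I : ℝ, IsGLB (majorIncrements f a b) I ∧ IsLUB (minorIncrements f a b) I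

/-- The Laplace integral `∫_a^b f`: the common value in the definition of Laplace integrability
(meaningful only if `LaplaceIntegrable f a b`). -/
def laplaceIntegral (f : ℝ → ℝ) (a b : ℝ) : ℝ :=
  sInf (majorIncrements f a b)

/-- `f` is Laplace integrable on `[a,∞]`: it is Laplace integrable on `[a,c]` for all `c ≥ a`,
and `∫_a^c f` converges to a real number as `c → ∞`. -/
def LaplaceIntegrableAtTop (f : ℝ → ℝ) (a : ℝ) : Prop :=
  (∀ c, a ≤ c → LaplaceIntegrable f a c) ∧
    ∃ L : ℝ, Tendsto (fun c => laplaceIntegral f a c) atTop (𝓝 L)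

/-- `f` is Laplace differentiable at `x` with `LD₁ f (x) = L`: for some `δ > 0`, `f` is Laplace
integrable on `[x-δ, x+δ]`, and both
`s² ∫₀^δ e^{-st} [f(x+t) - f(x)] dt` and `-s² ∫₀^δ e^{-st} [f(x-t) - f(x)] dt` exist as Laplace
integrals and tend to `L` as `s → ∞`. -/
def HasLaplaceDerivAt (f : ℝ → ℝ) (L x : ℝ) : Prop :=
  ∃ δ > 0, LaplaceIntegrable f (x - δ) (x + δ) ∧
    (∀ s > 0, LaplaceIntegrable (fun t => Real.exp (-(s * t)) * (f (x + t) - f x)) 0 δ ∧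
      LaplaceIntegrable (fun t => Real.exp (-(s * t)) * (f (x - t) - f x)) 0 δ) ∧
    Tendsto (fun s : ℝ =>
      s ^ 2 * laplaceIntegral (fun t => Real.exp (-(s * t)) * (f (x + t) - f x)) 0 δ)
      atTop (𝓝 L) ∧
    Tendsto (fun s : ℝ =>
      (-s ^ 2) * laplaceIntegral (fun t => Real.exp (-(s * t)) * (f (x - t) - f x)) 0 δ)
      atTop (𝓝 L)

end

/-! Write F for the indefinite integral. For a major function U on [a,b], the difference R = U - F
is nondecreasing, and U can be chosen so that R has total increment at most η
(`exists_isLaplaceMajor_sub_le`). By Lebesgue, R is differentiable almost everywhere and the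
integral of R' is at most that increment, so R' < ε off a set of measure at most η/ε
(`MonotoneOn.volume_le_deriv`).

Where R'(x) exists, the Laplace quotients of R tend to it, because s²te^{-st} is an approximate
identity of mass 1 (`tendsto_laplaceMean`). Quotients are linear and those of U have lower limit at
least f(x), so those of F eventually exceed f(x) - 2ε off a set of measure at most η/ε. Letting η →
0 and then ε → 0 gives the lower bound almost everywhere; applying it to -f gives the upper bound.

The Perron-type input is that U - V is nondecreasing for a major U and a minor V
(`monotoneOn_of_rightLaplaceQuot`). It also makes F continuous, so the Laplace integrals in
`HasLaplaceDerivAt` reduce to ordinary ones. -/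

/-! ### Laplace means and one-sided derivatives -/

/-- The Laplace mean `s² ∫₀^δ e^{-st} h(t) dt` of a function `h`. -/
noncomputable def laplaceMean (h : ℝ → ℝ) (δ s : ℝ) : ℝ :=
  s ^ 2 * ∫ t in (0 : ℝ)..δ, Real.exp (-(s * t)) * h t

theorem rightLaplaceQuot_eq_laplaceMean (U : ℝ → ℝ) (x δ s : ℝ) :
    rightLaplaceQuot U x δ s = laplaceMean (fun t => U (x + t) - U x) δ s := rfl

theorem leftLaplaceQuot_eq_laplaceMean (U : ℝ → ℝ) (x δ s : ℝ) :
    leftLaplaceQuot U x δ s = laplaceMean (fun t => U x - U (x - t)) δ s := by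
  rw [leftLaplaceQuot, laplaceMean, neg_mul, ← mul_neg, ← intervalIntegral.integral_neg]
  congr 2
  ext t
  ring

theorem intervalIntegrable_exp_mul {h : ℝ → ℝ} {δ : ℝ} (hδ : 0 ≤ δ)
    (hh : ContinuousOn h (Icc 0 δ)) (s : ℝ) :
    IntervalIntegrable (fun t => Real.exp (-(s * t)) * h t) volume 0 δ := by
  apply ContinuousOn.intervalIntegrable
  rw [uIcc_of_le hδ]
  exact (by fun_prop : ContinuousOn (fun t : ℝ => Real.exp (-(s * t))) (Icc 0 δ)).mul hh

theorem laplaceMean_sub {h k : ℝ → ℝ} {δ : ℝ} (hδ : 0 ≤ δ) (hh : ContinuousOn h (Icc 0 δ))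
    (hk : ContinuousOn k (Icc 0 δ)) (s : ℝ) :
    laplaceMean (fun t => h t - k t) δ s = laplaceMean h δ s - laplaceMean k δ s := by
  simp only [laplaceMean, mul_sub]
  rw [intervalIntegral.integral_sub (intervalIntegrable_exp_mul hδ hh s)
    (intervalIntegrable_exp_mul hδ hk s)]
  ring

theorem laplaceMean_nonpos {h : ℝ → ℝ} {δ : ℝ} (hδ : 0 ≤ δ) (hh : ∀ t ∈ Icc 0 δ, h t ≤ 0)
    (s : ℝ) : laplaceMean h δ s ≤ 0 := by
  have : 0 ≤ ∫ t in (0 : ℝ)..δ, -(Real.exp (-(s * t)) * h t) :=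
    intervalIntegral.integral_nonneg hδ fun t ht => by
      nlinarith [hh t ht, Real.exp_pos (-(s * t))]
  rw [intervalIntegral.integral_neg] at this
  exact mul_nonpos_of_nonneg_of_nonpos (sq_nonneg s) (by linarith)

theorem integrableOn_exp_neg_mul_self :
    IntegrableOn (fun u : ℝ => Real.exp (-u) * u) (Ioi 0) := by
  have := Real.GammaIntegral_convergent (s := 2) (by norm_num)
  refine this.congr_fun (fun u _ => ?_) measurableSet_Ioi
  norm_num

theorem integral_exp_neg_mul_self : ∫ u in Ioi (0 : ℝ), Real.exp (-u) * u = 1 := by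
  have := Real.Gamma_eq_integral (s := 2) (by norm_num)
  rw [Real.Gamma_two] at this
  rw [this]
  refine setIntegral_congr_fun measurableSet_Ioi fun u _ => ?_
  norm_num

/-- The substitution u = st fixes the kernel e^{-u}. When |h(t)| ≤ Ct, the integrand is dominated by
Cue^{-u} uniformly in s. -/
theorem laplaceMean_eq_setIntegral (h : ℝ → ℝ) {δ s : ℝ} (hδ : 0 ≤ δ) (hs : 0 < s) :
    laplaceMean h δ s =
      ∫ u in Ioi (0 : ℝ), (Ioc 0 (s * δ)).indicator (fun u => Real.exp (-u) * (s * h (u / s))) u := by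
  have key := intervalIntegral.mul_integral_comp_mul_left (a := 0) (b := δ)
    (f := fun u => Real.exp (-u) * (s * h (u / s))) (c := s)
  rw [setIntegral_indicator measurableSet_Ioc,
    inter_eq_right.2 (Ioc_subset_Ioi_self : Ioc 0 (s * δ) ⊆ Ioi 0),
    ← intervalIntegral.integral_of_le (by positivity)]
  rw [mul_zero] at key
  rw [← key, laplaceMean, sq, mul_assoc, ← intervalIntegral.integral_const_mul]
  congr 2
  ext t
  rw [mul_div_cancel_left₀ t hs.ne']
  ring

/-- The Laplace mean of `h` tends to the derivative of `h` at `0`, if `h` is linearly bounded. -/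
theorem tendsto_laplaceMean_of_le {h : ℝ → ℝ} {δ C L : ℝ} (hδ : 0 < δ)
    (hh : ContinuousOn h (Icc 0 δ)) (hC : ∀ t ∈ Ioc 0 δ, |h t| ≤ C * t)
    (hL : Tendsto (fun t => h t / t) (𝓝[>] 0) (𝓝 L)) :
    Tendsto (laplaceMean h δ) atTop (𝓝 L) := by
  have hlim : ∫ u in Ioi (0 : ℝ), (Real.exp (-u) * u) * L = L := by
    rw [integral_mul_const, integral_exp_neg_mul_self, one_mul]
  rw [← hlim]
  refine Tendsto.congr' (f₁ := fun s => ∫ u in Ioi (0 : ℝ),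
    (Ioc 0 (s * δ)).indicator (fun u => Real.exp (-u) * (s * h (u / s))) u) ?_ ?_
  · filter_upwards [eventually_gt_atTop 0] with s hs
    exact (laplaceMean_eq_setIntegral h hδ.le hs).symm
  have hmem : ∀ {s u : ℝ}, 0 < s → u ∈ Ioc 0 (s * δ) → u / s ∈ Ioc 0 δ := fun hs hu =>
    ⟨div_pos hu.1 hs, by rw [div_le_iff₀ hs, mul_comm]; exact hu.2⟩
  have hCpos : 0 ≤ C := by
    have := (abs_nonneg _).trans (hC δ ⟨hδ, le_rfl⟩)
    exact nonneg_of_mul_nonneg_left this hδ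
  refine tendsto_integral_filter_of_dominated_convergence
    (fun u => (Real.exp (-u) * u) * C) ?_ ?_ (integrableOn_exp_neg_mul_self.mul_const C) ?_
  · filter_upwards [eventually_gt_atTop 0] with s hs
    rw [aestronglyMeasurable_indicator_iff measurableSet_Ioc]
    refine AEStronglyMeasurable.mono_measure ?_ (Measure.restrict_mono_measure Measure.restrict_le_self _)
    refine ContinuousOn.aestronglyMeasurable ?_ measurableSet_Ioc
    refine (by fun_prop : ContinuousOn (fun u : ℝ => Real.exp (-u)) _).mul
      (continuousOn_const.mul (hh.comp (by fun_prop) fun u hu => ?_))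
    exact Ioc_subset_Icc_self (hmem hs hu)
  · filter_upwards [eventually_gt_atTop 0] with s hs
    refine (ae_restrict_iff' measurableSet_Ioi).2 (Eventually.of_forall fun u (hu0 : 0 < u) => ?_)
    by_cases hu : u ∈ Ioc 0 (s * δ)
    · rw [indicator_of_mem hu, Real.norm_eq_abs, abs_mul, abs_mul, abs_of_pos (Real.exp_pos _),
        abs_of_pos hs, mul_assoc]
      refine mul_le_mul_of_nonneg_left ?_ (Real.exp_pos _).le
      calc s * |h (u / s)| ≤ s * (C * (u / s)) :=
            mul_le_mul_of_nonneg_left (hC _ (hmem hs hu)) hs.le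
        _ = u * C := by field_simp
    · rw [indicator_of_notMem hu, norm_zero]
      positivity
  · refine (ae_restrict_iff' measurableSet_Ioi).2 (Eventually.of_forall fun u (hu : 0 < u) => ?_)
    have hdiv : Tendsto (fun s : ℝ => u / s) atTop (𝓝[>] 0) :=
      tendsto_nhdsWithin_iff.2 ⟨tendsto_const_nhds.div_atTop tendsto_id,
        (eventually_gt_atTop 0).mono fun s hs => div_pos hu hs⟩
    refine ((hL.comp hdiv).const_mul (Real.exp (-u) * u)).congr' ?_
    filter_upwards [eventually_gt_atTop 0, eventually_ge_atTop (u / δ)] with s hs hsu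
    rw [indicator_of_mem (mem_Ioc.2 ⟨hu, (div_le_iff₀ hδ).1 hsu⟩)]
    simp only [Function.comp_apply]
    field_simp

/-- The Laplace mean of `h` tends to the right derivative of `h` at `0`. -/
theorem tendsto_laplaceMean {h : ℝ → ℝ} {δ L : ℝ} (hδ : 0 < δ)
    (hh : ContinuousOn h (Icc 0 δ)) (hL : Tendsto (fun t => h t / t) (𝓝[>] 0) (𝓝 L)) :
    Tendsto (laplaceMean h δ) atTop (𝓝 L) := by
  obtain ⟨M, hM⟩ := isCompact_Icc.exists_bound_of_continuousOn hh
  have hb : ∀ᶠ t in 𝓝[>] 0, |h t / t| < |L| + 1 := hL.abs.eventually_lt_const (by linarith)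
  obtain ⟨η, hη0, hη⟩ := mem_nhdsGT_iff_exists_Ioo_subset.1 hb
  have hη0 : 0 < η := hη0
  -- Below η the bound on h(t)/t gives |L| + 1; from η on, |h| ≤ M ≤ (M/η)t.
  refine tendsto_laplaceMean_of_le (C := (|L| + 1) + M / η) hδ hh (fun t ht => ?_) hL
  have hM0 : 0 ≤ M := (norm_nonneg _).trans (hM t (Ioc_subset_Icc_self ht))
  rcases lt_or_ge t η with h1 | h1
  · have := hη ⟨ht.1, h1⟩
    rw [mem_ofPred_eq, abs_div, abs_of_pos ht.1, div_lt_iff₀ ht.1] at this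
    have h2 : 0 ≤ M / η * t := mul_nonneg (by positivity) ht.1.le
    linarith
  · have h2 : |h t| ≤ M := hM t (Ioc_subset_Icc_self ht)
    have h3 : M ≤ M / η * t := by
      rw [div_mul_eq_mul_div, le_div_iff₀ hη0]
      exact mul_le_mul_of_nonneg_left h1 hM0
    have h4 : 0 ≤ (|L| + 1) * t := mul_nonneg (by positivity) ht.1.le
    linarith

/-! ### Laplace quotients of continuous functions -/

theorem continuousOn_right_increment {U : ℝ → ℝ} {a b x δ : ℝ} (hU : ContinuousOn U (Icc a b))
    (hx : a ≤ x) (hδ : x + δ ≤ b) : ContinuousOn (fun t => U (x + t) - U x) (Icc 0 δ) :=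
  (hU.comp (by fun_prop) fun t ht => ⟨by linarith [ht.1], by linarith [ht.2]⟩).sub continuousOn_const

theorem continuousOn_left_increment {U : ℝ → ℝ} {a b x δ : ℝ} (hU : ContinuousOn U (Icc a b))
    (hx : x ≤ b) (hδ : a ≤ x - δ) : ContinuousOn (fun t => U x - U (x - t)) (Icc 0 δ) :=
  continuousOn_const.sub
    (hU.comp (by fun_prop) fun t ht => ⟨by linarith [ht.2], by linarith [ht.1]⟩)

theorem HasDerivAt.tendsto_rightLaplaceQuot {U : ℝ → ℝ} {a b x δ L : ℝ} (h : HasDerivAt U L x)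
    (hU : ContinuousOn U (Icc a b)) (hx : a ≤ x) (hδ : 0 < δ) (hb : x + δ ≤ b) :
    Tendsto (rightLaplaceQuot U x δ) atTop (𝓝 L) := by
  refine tendsto_laplaceMean hδ (continuousOn_right_increment hU hx hb) ?_
  refine h.tendsto_slope_zero_right.congr fun t => ?_
  rw [smul_eq_mul, div_eq_inv_mul]

theorem HasDerivAt.tendsto_leftLaplaceQuot {U : ℝ → ℝ} {a b x δ L : ℝ} (h : HasDerivAt U L x)
    (hU : ContinuousOn U (Icc a b)) (hx : x ≤ b) (hδ : 0 < δ) (ha : a ≤ x - δ) :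
    Tendsto (leftLaplaceQuot U x δ) atTop (𝓝 L) := by
  rw [funext (leftLaplaceQuot_eq_laplaceMean U x δ)]
  refine tendsto_laplaceMean hδ (continuousOn_left_increment hU hx ha) ?_
  have hneg : Tendsto (fun t : ℝ => -t) (𝓝[>] 0) (𝓝[<] 0) := by
    simpa using tendsto_neg_nhdsGT (a := (0 : ℝ))
  refine (h.tendsto_slope_zero_left.comp hneg).congr fun t => ?_
  simp only [Function.comp_apply, smul_eq_mul, ← sub_eq_add_neg]
  rw [div_eq_inv_mul, inv_neg]
  ring

theorem rightLaplaceQuot_sub {U V : ℝ → ℝ} {a b x δ : ℝ} (hU : ContinuousOn U (Icc a b))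
    (hV : ContinuousOn V (Icc a b)) (hx : a ≤ x) (hδ : 0 ≤ δ) (hb : x + δ ≤ b) (s : ℝ) :
    rightLaplaceQuot (fun y => U y - V y) x δ s
      = rightLaplaceQuot U x δ s - rightLaplaceQuot V x δ s := by
  simp only [rightLaplaceQuot_eq_laplaceMean]
  rw [← laplaceMean_sub hδ (continuousOn_right_increment hU hx hb)
    (continuousOn_right_increment hV hx hb)]
  congr 1
  ext t
  ring

theorem leftLaplaceQuot_sub {U V : ℝ → ℝ} {a b x δ : ℝ} (hU : ContinuousOn U (Icc a b))
    (hV : ContinuousOn V (Icc a b)) (hx : x ≤ b) (hδ : 0 ≤ δ) (ha : a ≤ x - δ) (s : ℝ) :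
    leftLaplaceQuot (fun y => U y - V y) x δ s
      = leftLaplaceQuot U x δ s - leftLaplaceQuot V x δ s := by
  simp only [leftLaplaceQuot_eq_laplaceMean]
  rw [← laplaceMean_sub hδ (continuousOn_left_increment hU hx ha)
    (continuousOn_left_increment hV hx ha)]
  congr 1
  ext t
  ring

/-- A continuous function whose lower right Laplace derivates are nonnegative is monotone. -/
theorem monotoneOn_of_rightLaplaceQuot {W : ℝ → ℝ} {a b : ℝ} (hW : ContinuousOn W (Icc a b))
    (h : ∀ x, a ≤ x → ∀ δ > 0, x + δ ≤ b → ∀ ε > 0,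
      ∀ᶠ s in atTop, -ε < rightLaplaceQuot W x δ s) :
    MonotoneOn W (Icc a b) := by
  intro c hc d hd hcd
  by_contra! hlt
  have hne : c < d := lt_of_le_of_ne hcd fun e => by simp [e] at hlt
  obtain ⟨ε, hε, hε'⟩ : ∃ ε > 0, ε * (d - c) < W c - W d :=
    ⟨(W c - W d) / (2 * (d - c)), div_pos (by linarith) (by linarith), by
      have : d - c ≠ 0 := by linarith
      field_simp
      linarith⟩
  have hcdab : Icc c d ⊆ Icc a b := Icc_subset_Icc hc.1 hd.2
  have hlin : ContinuousOn (fun y : ℝ => -ε * y) (Icc a b) := by fun_prop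
  -- The tilted function W(y) + εy is still larger at c than at d, so its maximum is attained at
  -- some x < d. There its right quotient is at most 0, while the hypothesis on W and the slope ε
  -- make it eventually positive.
  obtain ⟨x, hx, hmax⟩ := isCompact_Icc.exists_isMaxOn (nonempty_Icc.2 hcd)
    ((hW.sub hlin).mono hcdab)
  have hxd : x < d := lt_of_le_of_ne hx.2 fun e => by
    have := hmax (left_mem_Icc.2 hcd)
    simp only [mem_ofPred_eq, e, Pi.sub_apply] at this
    linarith
  have hδ : 0 < d - x := by linarith
  have hax : a ≤ x := hc.1.trans hx.1
  have hxb : x + (d - x) ≤ b := by linarith [hd.2]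
  have hder : HasDerivAt (fun y : ℝ => -ε * y) (-ε) x := by
    simpa using (hasDerivAt_id x).const_mul (-ε)
  have hev := (hder.tendsto_rightLaplaceQuot hlin hax hδ hxb).eventually_lt_const
    (by linarith : -ε < -(ε / 2))
  obtain ⟨s, h1, h2⟩ := ((h x hax _ hδ hxb (ε / 2) (by linarith)).and hev).exists
  have h3 := rightLaplaceQuot_sub hW hlin hax hδ.le hxb s
  have h4 : rightLaplaceQuot (fun y => W y - -ε * y) x (d - x) s ≤ 0 := by
    refine laplaceMean_nonpos hδ.le (fun t ht => ?_) s
    have := hmax (⟨by linarith [hx.1, ht.1], by linarith [ht.2]⟩ : x + t ∈ Icc c d)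
    simp only [mem_ofPred_eq, Pi.sub_apply] at this
    linarith
  linarith

/-! ### Major and minor functions, and the Laplace integral -/

section MajorMinor

variable {f U V : ℝ → ℝ} {a b c d x δ r : ℝ}

theorem rightLaplaceQuot_neg (U : ℝ → ℝ) (x δ s : ℝ) :
    rightLaplaceQuot (-U) x δ s = -rightLaplaceQuot U x δ s := by
  simp only [rightLaplaceQuot, Pi.neg_apply]
  rw [← mul_neg, ← intervalIntegral.integral_neg]
  congr 2
  ext t
  ring

theorem leftLaplaceQuot_neg (U : ℝ → ℝ) (x δ s : ℝ) :
    leftLaplaceQuot (-U) x δ s = -leftLaplaceQuot U x δ s := by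
  simp only [leftLaplaceQuot, Pi.neg_apply]
  rw [← mul_neg, ← intervalIntegral.integral_neg]
  congr 2
  ext t
  ring

theorem EReal.liminf_coe_neg (u : ℝ → ℝ) (l : Filter ℝ) :
    liminf (fun s => -(u s : EReal)) l = -limsup (fun s => (u s : EReal)) l := by
  rw [← EReal.liminf_neg]
  rfl

theorem EReal.limsup_coe_neg (u : ℝ → ℝ) (l : Filter ℝ) :
    limsup (fun s => -(u s : EReal)) l = -liminf (fun s => (u s : EReal)) l := by
  rw [← EReal.limsup_neg]
  rfl

theorem IsLaplaceMinor.neg (hV : IsLaplaceMinor f a b V) : IsLaplaceMajor (-f) a b (-V) where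
  continuousOn := hV.continuousOn.neg
  le_right x hx δ hδ hb := by
    simp only [rightLaplaceQuot_neg, EReal.liminf_coe_neg, Pi.neg_apply, EReal.coe_neg,
      EReal.neg_le_neg_iff]
    exact hV.right_le x hx δ hδ hb
  le_left x hx δ hδ ha := by
    simp only [leftLaplaceQuot_neg, EReal.liminf_coe_neg, Pi.neg_apply, EReal.coe_neg,
      EReal.neg_le_neg_iff]
    exact hV.left_le x hx δ hδ ha

theorem IsLaplaceMajor.neg (hU : IsLaplaceMajor f a b U) : IsLaplaceMinor (-f) a b (-U) where
  continuousOn := hU.continuousOn.neg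
  right_le x hx δ hδ hb := by
    simp only [rightLaplaceQuot_neg, EReal.limsup_coe_neg, Pi.neg_apply, EReal.coe_neg,
      EReal.neg_le_neg_iff]
    exact hU.le_right x hx δ hδ hb
  left_le x hx δ hδ ha := by
    simp only [leftLaplaceQuot_neg, EReal.limsup_coe_neg, Pi.neg_apply, EReal.coe_neg,
      EReal.neg_le_neg_iff]
    exact hU.le_left x hx δ hδ ha

theorem IsLaplaceMajor.eventually_lt_right (hU : IsLaplaceMajor f a b U) (hx : a ≤ x)
    (hδ : 0 < δ) (hb : x + δ ≤ b) (hr : r < f x) :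
    ∀ᶠ s in atTop, r < rightLaplaceQuot U x δ s :=
  (eventually_lt_of_lt_liminf ((EReal.coe_lt_coe_iff.2 hr).trans_le
    (hU.le_right x hx δ hδ hb))).mono fun _ h => EReal.coe_lt_coe_iff.1 h

theorem IsLaplaceMajor.eventually_lt_left (hU : IsLaplaceMajor f a b U) (hx : x ≤ b)
    (hδ : 0 < δ) (ha : a ≤ x - δ) (hr : r < f x) :
    ∀ᶠ s in atTop, r < leftLaplaceQuot U x δ s :=
  (eventually_lt_of_lt_liminf ((EReal.coe_lt_coe_iff.2 hr).trans_le
    (hU.le_left x hx δ hδ ha))).mono fun _ h => EReal.coe_lt_coe_iff.1 h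

theorem IsLaplaceMinor.eventually_right_lt (hV : IsLaplaceMinor f a b V) (hx : a ≤ x)
    (hδ : 0 < δ) (hb : x + δ ≤ b) (hr : f x < r) :
    ∀ᶠ s in atTop, rightLaplaceQuot V x δ s < r :=
  (eventually_lt_of_limsup_lt ((hV.right_le x hx δ hδ hb).trans_lt
    (EReal.coe_lt_coe_iff.2 hr))).mono fun _ h => EReal.coe_lt_coe_iff.1 h

theorem IsLaplaceMajor.mono (hU : IsLaplaceMajor f a b U) (ha : a ≤ c) (hb : d ≤ b) :
    IsLaplaceMajor f c d U where
  continuousOn := hU.continuousOn.mono (Icc_subset_Icc ha hb)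
  le_right x hx δ hδ hd := hU.le_right x (ha.trans hx) δ hδ (hd.trans hb)
  le_left x hx δ hδ hc := hU.le_left x (hx.trans hb) δ hδ (ha.trans hc)

theorem IsLaplaceMinor.mono (hV : IsLaplaceMinor f a b V) (ha : a ≤ c) (hb : d ≤ b) :
    IsLaplaceMinor f c d V where
  continuousOn := hV.continuousOn.mono (Icc_subset_Icc ha hb)
  right_le x hx δ hδ hd := hV.right_le x (ha.trans hx) δ hδ (hd.trans hb)
  left_le x hx δ hδ hc := hV.left_le x (hx.trans hb) δ hδ (ha.trans hc)

theorem IsLaplaceMajor.monotoneOn_sub (hU : IsLaplaceMajor f a b U)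
    (hV : IsLaplaceMinor f a b V) : MonotoneOn (fun y => U y - V y) (Icc a b) := by
  refine monotoneOn_of_rightLaplaceQuot (hU.continuousOn.sub hV.continuousOn)
    fun x hx δ hδ hb ε hε => ?_
  filter_upwards [hU.eventually_lt_right hx hδ hb (r := f x - ε / 2) (by linarith),
    hV.eventually_right_lt hx hδ hb (r := f x + ε / 2) (by linarith)] with s h1 h2
  rw [rightLaplaceQuot_sub hU.continuousOn hV.continuousOn hx hδ.le hb]
  linarith

/-- Negation exchanges major and minor functions; this is what turns lower estimates for -f into
upper estimates for f. -/
theorem minorIncrements_neg (f : ℝ → ℝ) (a b : ℝ) :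
    minorIncrements (-f) a b = -majorIncrements f a b := by
  ext r
  simp only [minorIncrements, majorIncrements, mem_ofPred_eq, Set.mem_neg]
  constructor
  · rintro ⟨V, hV, rfl⟩
    exact ⟨-V, by simpa using hV.neg, by simp only [Pi.neg_apply]; ring⟩
  · rintro ⟨U, hU, hr⟩
    exact ⟨-U, hU.neg, by simp only [Pi.neg_apply]; linarith⟩

theorem majorIncrements_neg (f : ℝ → ℝ) (a b : ℝ) :
    majorIncrements (-f) a b = -minorIncrements f a b := by
  rw [← neg_neg (majorIncrements (-f) a b), ← minorIncrements_neg, neg_neg]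

theorem LaplaceIntegrable.isGLB (h : LaplaceIntegrable f a b) :
    IsGLB (majorIncrements f a b) (laplaceIntegral f a b) :=
  isGLB_csInf h.2.1 (let ⟨_, hI, _⟩ := h.2.2.2; hI.bddBelow)

theorem LaplaceIntegrable.isLUB (h : LaplaceIntegrable f a b) :
    IsLUB (minorIncrements f a b) (laplaceIntegral f a b) := by
  obtain ⟨I, hI, hI'⟩ := h.2.2.2
  rwa [h.isGLB.unique hI]

theorem LaplaceIntegrable.neg (h : LaplaceIntegrable f a b) : LaplaceIntegrable (-f) a b := by
  refine ⟨h.1, ?_, ?_, -laplaceIntegral f a b, ?_, ?_⟩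
  · rw [majorIncrements_neg]; exact h.2.2.1.neg
  · rw [minorIncrements_neg]; exact h.2.1.neg
  · rw [majorIncrements_neg]; exact h.isLUB.neg
  · rw [minorIncrements_neg]; exact h.isGLB.neg

theorem LaplaceIntegrable.laplaceIntegral_neg (h : LaplaceIntegrable f a b) :
    laplaceIntegral (-f) a b = -laplaceIntegral f a b := by
  refine h.neg.isGLB.unique ?_
  rw [majorIncrements_neg]
  exact h.isLUB.neg

/-- A function that is both a major and a minor function determines the integral. -/
theorem IsLaplaceMajor.laplaceIntegral_eq (hab : a ≤ b) (hU : IsLaplaceMajor f a b U)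
    (hV : IsLaplaceMinor f a b U) :
    LaplaceIntegrable f a b ∧ laplaceIntegral f a b = U b - U a := by
  have ha := left_mem_Icc.2 hab
  have hb := right_mem_Icc.2 hab
  have hglb : IsGLB (majorIncrements f a b) (U b - U a) := by
    refine IsLeast.isGLB ⟨⟨U, hU, rfl⟩, ?_⟩
    rintro _ ⟨U', hU', rfl⟩
    have := hU'.monotoneOn_sub hV ha hb hab
    simp only at this
    linarith
  have hlub : IsLUB (minorIncrements f a b) (U b - U a) := by
    refine IsGreatest.isLUB ⟨⟨U, hV, rfl⟩, ?_⟩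
    rintro _ ⟨V', hV', rfl⟩
    have := hU.monotoneOn_sub hV' ha hb hab
    simp only at this
    linarith
  have h : LaplaceIntegrable f a b := ⟨hab, ⟨_, U, hU, rfl⟩, ⟨_, U, hV, rfl⟩, _, hglb, hlub⟩
  exact ⟨h, h.isGLB.unique hglb⟩

/-- A continuous function is Laplace integrable, and its Laplace integral is the usual one. -/
theorem ContinuousOn.laplaceIntegral_eq {g : ℝ → ℝ} (hab : a ≤ b) (hg : ContinuousOn g (Icc a b)) :
    LaplaceIntegrable g a b ∧ laplaceIntegral g a b = ∫ t in a..b, g t := by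
  -- Extending g by constants beyond the endpoints gives a primitive with a two-sided derivative at
  -- every point of [a,b], endpoints included.
  set G := IccExtend hab ((Icc a b).domRestrict g)
  have hG : Continuous G := hg.domRestrict.Icc_extend'
  have hGg : ∀ x ∈ Icc a b, G x = g x := fun x hx => IccExtend_of_mem hab _ hx
  have hder : ∀ x, HasDerivAt (fun y => ∫ t in a..y, G t) (G x) x := fun x =>
    intervalIntegral.integral_hasDerivAt_right (hG.intervalIntegrable _ _)
      (hG.stronglyMeasurableAtFilter _ _) hG.continuousAt
  have hc : ContinuousOn (fun y => ∫ t in a..y, G t) (Icc a b) := fun x _ =>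
    (hder x).continuousAt.continuousWithinAt
  have hr : ∀ x, a ≤ x → ∀ δ > 0, x + δ ≤ b → Tendsto (fun s =>
      (rightLaplaceQuot (fun y => ∫ t in a..y, G t) x δ s : EReal)) atTop (𝓝 (g x : EReal)) :=
    fun x hx δ hδ hb => EReal.tendsto_coe.2 <| by
      rw [← hGg x ⟨hx, by linarith⟩]
      exact (hder x).tendsto_rightLaplaceQuot hc hx hδ hb
  have hl : ∀ x, x ≤ b → ∀ δ > 0, a ≤ x - δ → Tendsto (fun s =>
      (leftLaplaceQuot (fun y => ∫ t in a..y, G t) x δ s : EReal)) atTop (𝓝 (g x : EReal)) :=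
    fun x hx δ hδ ha => EReal.tendsto_coe.2 <| by
      rw [← hGg x ⟨by linarith, hx⟩]
      exact (hder x).tendsto_leftLaplaceQuot hc hx hδ ha
  obtain ⟨h1, h2⟩ := IsLaplaceMajor.laplaceIntegral_eq (f := g) hab
    ⟨hc, fun x hx δ hδ hb => (hr x hx δ hδ hb).liminf_eq.ge,
      fun x hx δ hδ ha => (hl x hx δ hδ ha).liminf_eq.ge⟩
    ⟨hc, fun x hx δ hδ hb => (hr x hx δ hδ hb).limsup_eq.le,
      fun x hx δ hδ ha => (hl x hx δ hδ ha).limsup_eq.le⟩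
  refine ⟨h1, h2.trans ?_⟩
  rw [intervalIntegral.integral_same, sub_zero]
  refine intervalIntegral.integral_congr fun t ht => hGg t ?_
  rwa [uIcc_of_le hab] at ht

end MajorMinor

/-! ### The indefinite integral and its Laplace quotients -/

section Primitive

variable {f U V : ℝ → ℝ} {a b : ℝ}

/-- For a minor V on [a,y], split V(y) - V(a) at x: the part on [a,x] is at most the integral up to
x, the part on [x,y] at most U(y) - U(x). The supremum over V gives the claim without additivity of
the integral. -/
theorem IsLaplaceMajor.monotoneOn_sub_laplaceIntegral
    (hf : ∀ c, a ≤ c → LaplaceIntegrable f a c) (hU : IsLaplaceMajor f a b U) :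
    MonotoneOn (fun y => U y - laplaceIntegral f a y) (Icc a b) := by
  intro x hx y hy hxy
  have : laplaceIntegral f a y ≤ laplaceIntegral f a x + (U y - U x) := by
    refine (hf y hy.1).isLUB.2 ?_
    rintro _ ⟨V, hV, rfl⟩
    have h1 := (hU.mono hx.1 hy.2).monotoneOn_sub (hV.mono hx.1 le_rfl)
      (left_mem_Icc.2 hxy) (right_mem_Icc.2 hxy) hxy
    have h2 := (hf x hx.1).isLUB.1 ⟨V, hV.mono le_rfl hxy, rfl⟩
    simp only at h1
    linarith
  simp only
  linarith

theorem laplaceIntegral_self (hf : LaplaceIntegrable f a a) : laplaceIntegral f a a = 0 := by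
  obtain ⟨_, U, hU, rfl⟩ := hf.2.1
  obtain ⟨_, V, hV, rfl⟩ := hf.2.2.1
  have h1 := hf.isGLB.1 ⟨U, hU, rfl⟩
  have h2 := hf.isLUB.1 ⟨V, hV, rfl⟩
  linarith

/-- There are major functions whose distance to the indefinite integral is arbitrarily small. -/
theorem exists_isLaplaceMajor_sub_le (hf : ∀ c, a ≤ c → LaplaceIntegrable f a c) (hab : a ≤ b)
    {η : ℝ} (hη : 0 < η) : ∃ U, IsLaplaceMajor f a b U ∧
      (U b - laplaceIntegral f a b) - (U a - laplaceIntegral f a a) ≤ η := by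
  obtain ⟨_, ⟨U, hU, rfl⟩, -, h⟩ := (hf b hab).isGLB.exists_between
    (by linarith : laplaceIntegral f a b < laplaceIntegral f a b + η)
  exact ⟨U, hU, by rw [laplaceIntegral_self (hf a le_rfl)]; linarith⟩

/-- The integral is a uniform limit of the continuous functions U - U(a): the error is
nondecreasing, vanishes at a and is small at b. -/
theorem continuousOn_laplaceIntegral (hf : ∀ c, a ≤ c → LaplaceIntegrable f a c) :
    ContinuousOn (laplaceIntegral f a) (Icc a b) := by
  rcases lt_or_ge b a with hab | hab
  · simp [Icc_eq_empty hab.not_ge]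
  refine continuousOn_of_uniform_approx_of_continuousOn fun u hu => ?_
  obtain ⟨ε, hε, hεu⟩ := Metric.mem_uniformity_dist.1 hu
  obtain ⟨U, hU, hUε⟩ := exists_isLaplaceMajor_sub_le hf hab (half_pos hε)
  refine ⟨fun y => U y - U a, hU.continuousOn.sub continuousOn_const, fun y hy => hεu ?_⟩
  have hmono := hU.monotoneOn_sub_laplaceIntegral hf
  have h1 := hmono (left_mem_Icc.2 hab) hy hy.1
  have h2 := hmono hy (right_mem_Icc.2 hab) hy.2
  simp only [laplaceIntegral_self (hf a le_rfl)] at h1 h2 hUε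
  rw [Real.dist_eq, abs_lt]
  constructor <;> linarith

/-- A monotone function with small increment has a small derivative outside of a small set. -/
theorem MonotoneOn.volume_le_deriv {R : ℝ → ℝ} (hab : a ≤ b) (hR : MonotoneOn R (Icc a b))
    {ε : ℝ} (hε : 0 < ε) :
    volume {x ∈ Ioo a b | ε ≤ deriv R x} ≤ ENNReal.ofReal ((R b - R a) / ε) := by
  have hR' : MonotoneOn R (uIcc a b) := by rwa [uIcc_of_le hab]
  have hRab : R a ≤ R b := hR (left_mem_Icc.2 hab) (right_mem_Icc.2 hab) hab
  -- Only an inequality is available, since R may have a singular part; it suffices for Markov's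
  -- inequality.
  have hint := hR'.intervalIntegral_deriv_mem_uIcc
  rw [uIcc_of_le (by linarith), intervalIntegral.integral_of_le hab,
    integral_Ioc_eq_integral_Ioo] at hint
  have hI : IntegrableOn (deriv R) (Ioo a b) :=
    ((intervalIntegrable_iff_integrableOn_Ioc_of_le hab).1 hR'.intervalIntegrable_deriv).mono_set
      Ioo_subset_Ioc_self
  have hnn : 0 ≤ᵐ[volume.restrict (Ioo a b)] deriv R := by
    refine (ae_restrict_iff' measurableSet_Ioo).2 (Eventually.of_forall fun x hx => ?_)
    rw [← derivWithin_of_mem_nhds (Icc_mem_nhds hx.1 hx.2)]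
    exact hR.derivWithin_nonneg
  have hm := mul_meas_ge_le_integral_of_nonneg hnn hI ε
  rw [measureReal_def, Measure.restrict_apply' measurableSet_Ioo] at hm
  have hfin : volume ({x | ε ≤ deriv R x} ∩ Ioo a b) ≠ ⊤ :=
    measure_ne_top_of_subset inter_subset_right measure_Ioo_lt_top.ne
  have hset : {x ∈ Ioo a b | ε ≤ deriv R x} = {x | ε ≤ deriv R x} ∩ Ioo a b := by
    ext x
    exact and_comm
  rw [hset, ← ENNReal.ofReal_toReal hfin]
  refine ENNReal.ofReal_le_ofReal ?_
  rw [le_div_iff₀ hε]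
  linarith [hint.2]

/-- The indefinite integral almost everywhere has lower Laplace derivates at least `f`. -/
theorem ae_eventually_lt_laplaceQuot_laplaceIntegral
    (hf : ∀ c, a ≤ c → LaplaceIntegrable f a c) (hab : a ≤ b) {ε : ℝ} (hε : 0 < ε) :
    ∀ᵐ x, x ∈ Ioo a b → ∀ δ > 0, a ≤ x - δ → x + δ ≤ b →
      (∀ᶠ s in atTop, f x - ε < rightLaplaceQuot (laplaceIntegral f a) x δ s) ∧
      (∀ᶠ s in atTop, f x - ε < leftLaplaceQuot (laplaceIntegral f a) x δ s) := by
  set F := laplaceIntegral f a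
  have hF : ContinuousOn F (Icc a b) := continuousOn_laplaceIntegral hf
  rw [ae_iff]
  refine nonpos_iff_eq_zero.1 (le_of_forall_gt fun η hη => ?_)
  obtain ⟨η', hη'0, hη'⟩ := ENNReal.lt_iff_exists_nnreal_btwn.1 hη
  have hη'pos : (0 : ℝ) < η' := by exact_mod_cast hη'0
  -- With increment at most η'·(ε/2), the set where R' ≥ ε/2 has measure at most η'. The other ε/2
  -- absorbs the strict inequality for the quotients of U.
  obtain ⟨U, hU, hUη⟩ := exists_isLaplaceMajor_sub_le hf hab
    (mul_pos hη'pos (half_pos hε))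
  set R := fun y => U y - F y with hRdef
  have hR : MonotoneOn R (Icc a b) := hU.monotoneOn_sub_laplaceIntegral hf
  have hRc : ContinuousOn R (Icc a b) := hU.continuousOn.sub hF
  have hFR : F = fun y => U y - R y := by
    ext y
    simp [hRdef]
  refine lt_of_le_of_lt (le_trans (measure_mono_ae (t := {x ∈ Ioo a b | ε / 2 ≤ deriv R x}) ?_)
    (hR.volume_le_deriv hab (half_pos hε))) (lt_of_le_of_lt ?_ hη')
  · filter_upwards [hR.ae_differentiableWithinAt_of_mem] with x hx hbad
    by_contra hgood
    refine hbad fun hxab δ hδ ha hb => ?_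
    have hd : HasDerivAt R (deriv R x) x :=
      ((hx (Ioo_subset_Icc_self hxab)).differentiableAt (Icc_mem_nhds hxab.1 hxab.2)).hasDerivAt
    have hlt : deriv R x < ε / 2 := by
      by_contra hge
      exact hgood ⟨hxab, not_lt.1 hge⟩
    constructor
    · filter_upwards [hU.eventually_lt_right hxab.1.le hδ hb (r := f x - ε / 2) (by linarith),
        (hd.tendsto_rightLaplaceQuot hRc hxab.1.le hδ hb).eventually_lt_const hlt] with s h1 h2
      rw [hFR, rightLaplaceQuot_sub hU.continuousOn hRc hxab.1.le hδ.le hb]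
      linarith
    · filter_upwards [hU.eventually_lt_left hxab.2.le hδ ha (r := f x - ε / 2) (by linarith),
        (hd.tendsto_leftLaplaceQuot hRc hxab.2.le hδ ha).eventually_lt_const hlt] with s h1 h2
      rw [hFR, leftLaplaceQuot_sub hU.continuousOn hRc hxab.2.le hδ.le ha]
      linarith
  · rw [← ENNReal.ofReal_coe_nnreal]
    refine ENNReal.ofReal_le_ofReal ?_
    rw [div_le_iff₀ (half_pos hε)]
    exact hUη

/-- The indefinite integral almost everywhere has Laplace quotients tending to `f`. -/
theorem ae_tendsto_laplaceQuot_laplaceIntegral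
    (hf : ∀ c, a ≤ c → LaplaceIntegrable f a c) (hab : a ≤ b) :
    ∀ᵐ x, x ∈ Ioo a b → ∀ δ > 0, a ≤ x - δ → x + δ ≤ b →
      Tendsto (rightLaplaceQuot (laplaceIntegral f a) x δ) atTop (𝓝 (f x)) ∧
      Tendsto (leftLaplaceQuot (laplaceIntegral f a) x δ) atTop (𝓝 (f x)) := by
  have hlow := ae_all_iff.2 fun n : ℕ => ae_eventually_lt_laplaceQuot_laplaceIntegral hf hab
    (Nat.one_div_pos_of_nat (n := n) (α := ℝ))
  -- The lower bound for -f is the upper bound for f; the countably many ε = 1/(n+1) keep the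
  -- exceptional set null.
  have hup := ae_all_iff.2 fun n : ℕ => ae_eventually_lt_laplaceQuot_laplaceIntegral
    (fun c hc => (hf c hc).neg) hab (Nat.one_div_pos_of_nat (n := n) (α := ℝ))
  filter_upwards [hlow, hup] with x h1 h2 hx δ hδ ha hb
  have hr : ∀ s, rightLaplaceQuot (laplaceIntegral (-f) a) x δ s
      = -rightLaplaceQuot (laplaceIntegral f a) x δ s := fun s => by
    rw [← rightLaplaceQuot_neg]
    simp only [rightLaplaceQuot_eq_laplaceMean, laplaceMean, Pi.neg_apply]
    congr 1
    refine intervalIntegral.integral_congr fun t ht => ?_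
    rw [uIcc_of_le hδ.le] at ht
    rw [(hf x hx.1.le).laplaceIntegral_neg, (hf (x + t) (by linarith [ht.1])).laplaceIntegral_neg]
  have hl : ∀ s, leftLaplaceQuot (laplaceIntegral (-f) a) x δ s
      = -leftLaplaceQuot (laplaceIntegral f a) x δ s := fun s => by
    rw [← leftLaplaceQuot_neg]
    simp only [leftLaplaceQuot_eq_laplaceMean, laplaceMean, Pi.neg_apply]
    congr 1
    refine intervalIntegral.integral_congr fun t ht => ?_
    rw [uIcc_of_le hδ.le] at ht
    rw [(hf x hx.1.le).laplaceIntegral_neg, (hf (x - t) (by linarith [ht.2])).laplaceIntegral_neg]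
  constructor <;> refine Metric.tendsto_nhds.2 fun ε hε => ?_ <;>
    obtain ⟨n, hn⟩ := exists_nat_one_div_lt hε
  · filter_upwards [(h1 n hx δ hδ ha hb).1, (h2 n hx δ hδ ha hb).1] with s h3 h4
    rw [hr, Pi.neg_apply] at h4
    rw [Real.dist_eq, abs_lt]
    constructor <;> linarith
  · filter_upwards [(h1 n hx δ hδ ha hb).2, (h2 n hx δ hδ ha hb).2] with s h3 h4
    rw [hl, Pi.neg_apply] at h4
    rw [Real.dist_eq, abs_lt]
    constructor <;> linarith

end Primitive

/-! ### Laplace derivatives and the main theorem -/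

/-- For continuous functions, the Laplace derivative is the common limit of the quotients. -/
theorem ContinuousOn.hasLaplaceDerivAt {F : ℝ → ℝ} {x δ L : ℝ} (hδ : 0 < δ)
    (hF : ContinuousOn F (Icc (x - δ) (x + δ)))
    (hr : Tendsto (rightLaplaceQuot F x δ) atTop (𝓝 L))
    (hl : Tendsto (leftLaplaceQuot F x δ) atTop (𝓝 L)) : HasLaplaceDerivAt F L x := by
  have hcr : ∀ s : ℝ, ContinuousOn (fun t => Real.exp (-(s * t)) * (F (x + t) - F x)) (Icc 0 δ) :=
    fun s => (by fun_prop : ContinuousOn (fun t : ℝ => Real.exp (-(s * t))) (Icc 0 δ)).mul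
      (continuousOn_right_increment hF (by linarith) le_rfl)
  have hcl : ∀ s : ℝ, ContinuousOn (fun t => Real.exp (-(s * t)) * (F (x - t) - F x)) (Icc 0 δ) :=
    fun s => (by fun_prop : ContinuousOn (fun t : ℝ => Real.exp (-(s * t))) (Icc 0 δ)).mul
      ((continuousOn_left_increment hF (by linarith) le_rfl).neg.congr fun t _ => by simp)
  refine ⟨δ, hδ, (hF.laplaceIntegral_eq (by linarith)).1, fun s _ =>
    ⟨((hcr s).laplaceIntegral_eq hδ.le).1, ((hcl s).laplaceIntegral_eq hδ.le).1⟩,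
    hr.congr fun s => ?_, hl.congr fun s => ?_⟩
  · rw [((hcr s).laplaceIntegral_eq hδ.le).2, rightLaplaceQuot]
  · rw [((hcl s).laplaceIntegral_eq hδ.le).2, leftLaplaceQuot]

theorem mainTheorem11 (a : ℝ) (f F : ℝ → ℝ) (hf : LaplaceIntegrableAtTop f a)
    (hF : ∀ x, a ≤ x → F x = laplaceIntegral f a x) :
    ∀ᵐ x ∂(volume.restrict (Set.Ici a)), HasLaplaceDerivAt F (f x) x := by
  -- The null point a is dropped, so that every x has room on its left.
  rw [← restrict_Ioi_eq_restrict_Ici, ae_restrict_iff' measurableSet_Ioi]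
  have h := ae_all_iff.2 fun n : ℕ =>
    ae_tendsto_laplaceQuot_laplaceIntegral hf.1 (le_add_of_nonneg_right (Nat.cast_nonneg n))
  filter_upwards [h] with x hx (hax : a < x)
  -- With δ = x - a, the interval [x - δ, x + δ] starts at a and has length 2(x - a), so it lies in
  -- [a, a + n].
  obtain ⟨n, hn⟩ := exists_nat_ge ((x - a) + (x - a))
  have hδ : 0 < x - a := by linarith
  obtain ⟨hr, hl⟩ := hx n ⟨hax, by linarith⟩ (x - a) hδ (by linarith) (by linarith)
  refine ContinuousOn.hasLaplaceDerivAt hδ ?_ (hr.congr fun s => ?_) (hl.congr fun s => ?_)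
  · rw [sub_sub_cancel]
    exact (continuousOn_laplaceIntegral hf.1).congr fun y hy => hF y hy.1
  · rw [rightLaplaceQuot, rightLaplaceQuot]
    congr 1
    refine intervalIntegral.integral_congr fun t ht => ?_
    rw [uIcc_of_le hδ.le] at ht
    rw [hF x hax.le, hF (x + t) (by linarith [ht.1])]
  · rw [leftLaplaceQuot, leftLaplaceQuot]
    congr 1
    refine intervalIntegral.integral_congr fun t ht => ?_
    rw [uIcc_of_le hδ.le] at ht
    rw [hF x hax.le, hF (x - t) (by linarith [ht.2])]
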